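/- All objects are smooth ($C^\infty$). Let $I\subset\mathbb{R}$ be a nonempty open interval (possibly $I=\mathbb{R}$, or a neighbourhood of a point). An ODE in normal form $dx/dt=X(t,x)$, $(t,x)\in\mathbb{R}\times I$, with $X$ smooth is identified with the $t$-dependent vector field $X(t,x)\,\partial_x$ on $I$. An *Abel equation of degree $q$* on an open set $J\subset\mathbb{R}$ is an equation $dy/dt=a_0(t)+a_1(t)y+\dots+a_q(t)y^q$, $y\in J$, with smooth $a_0,\dots,a_q:\mathbb{R}\to\mathbb{R}$ ($a_q=0$ is allowed). A *quasi-Lie scheme* $S(W,V)$ on $I$ consists of finite-dimensional real vector spaces $W\subset V$ of smooth vector fields on $I$ with $[W,W]\subset W$ and $[W,V]\subset V$. Its *quasi-Lie family* $\mathcal V$ is the set of smooth $t$-dependent vector fields $X$ on $I$ with $X(t,\cdot)\,\partial_x\in V$ for every $t\in\mathbb{R}$. A space $E$ of vector fields on $I$ is *faithful at* $x_0\in I$ if the zero field is the only element of $E$ that vanishes on a neighbourhood of $x_0$ (equivalently, for finite-dimensional $E$, the germs at $x_0$ of the elements of $E$ form a space of dimension $\dim E$). **Theorem.** Let $q\ge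 3$ and let $dx/dt=X(t,x)$ be a first-order ODE in normal form on $I$, with $X$ smooth. 1. There is a $t$-independent change of variables $y=\varphi(x)$, with $\varphi$ a smooth diffeomorphism from $I$ onto an open subset of $\mathbb{R}$, that transforms the equation into an Abel equation of degree $q$ on $\varphi(I)$ if and only if $X$ belongs to the quasi-Lie family of a quasi-Lie scheme $S(W,V)$ on $I$ with $\dim W=2$, $\dim V=q+1$ and $V$ faithful at every point of $I$. 2. Suppose that $X$ belongs to the quasi-Lie family of any quasi-Lie scheme $S(W,V)$ on $I$ with $\dim W=2$ and $\dim V=q+1$. Then around every $x_0\in I$ at which $W$ is faithful and not all elements of $W$ vanish, there is a $t$-independent change of variables, i.e. a smooth diffeomorphism $\varphi$ from an open neighbourhood $U\subset I$ of $x_0$ onto an open subset of $\mathbb{R}$, that transforms the restriction of the equation to $U$ into an Abel equation of degree $q$ on $\varphi(U)$. -/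

import Mathlib

open Set Topology
open scoped ContDiff

namespace QuasiLie

/-! Vector fields on an open set `I` of the real line. The function `f : I → ℝ` stands for the
vector field `f(x) ∂/∂x` on `I`, and `X : ℝ → I → ℝ` for the `t`-dependent vector field
`X(t,x) ∂/∂x`, that is, for the ODE in normal form `dx/dt = X(t,x)`, with `t ∈ ℝ` and `x ∈ I`. -/

/-- Extension by zero of a function on `I`. It only serves to differentiate at points of the open
set `I`, where the values outside `I` play no role. -/
noncomputable def extendZero {I : Set ℝ} (f : I → ℝ) : ℝ → ℝ :=
  Function.extend Subtype.val f 0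

theorem extendZero_apply {I : Set ℝ} (f : I → ℝ) (x : I) : extendZero f x = f x :=
  Subtype.val_injective.extend_apply f 0 x

/-- `f(x) ∂/∂x` is a smooth vector field on `I`. -/
def IsSmoothField {I : Set ℝ} (f : I → ℝ) : Prop :=
  ContDiffOn ℝ ∞ (extendZero f) I

/-- `X(t,x) ∂/∂x` is a smooth `t`-dependent vector field on `I` (smooth in `(t,x)` jointly). -/
def IsSmoothTDepField {I : Set ℝ} (X : ℝ → I → ℝ) : Prop :=
  ContDiffOn ℝ ∞ (fun p : ℝ × ℝ => extendZero (X p.1) p.2) (univ ×ˢ I)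

/-- The Lie bracket of two vector fields on `I`. -/
noncomputable def bracket {I : Set ℝ} (f g : I → ℝ) : I → ℝ :=
  fun x => VectorField.lieBracket ℝ (extendZero f) (extendZero g) x

/-- In the coordinate `x`, `[f ∂/∂x, g ∂/∂x] = (f g' - g f') ∂/∂x`. -/
theorem bracket_apply {I : Set ℝ} (f g : I → ℝ) (x : I) :
    bracket f g x = f x * deriv (extendZero g) x - g x * deriv (extendZero f) x := by
  simp [bracket, VectorField.lieBracket, extendZero_apply]

/-- `S(W,V)` is a quasi-Lie scheme on `I`: `W` and `V` are finite-dimensional real vector spaces of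
smooth vector fields on `I` with `[W,W] ⊆ W ⊆ V` and `[W,V] ⊆ V`. -/
structure IsQuasiLieScheme {I : Set ℝ} (W V : Submodule ℝ (I → ℝ)) : Prop where
  smooth : ∀ f ∈ V, IsSmoothField f
  finite : FiniteDimensional ℝ V
  le : W ≤ V
  bracket_mem : ∀ f ∈ W, ∀ g ∈ W, bracket f g ∈ W
  normalises : ∀ f ∈ W, ∀ g ∈ V, bracket f g ∈ V

/-- The quasi-Lie family of `V`: the smooth `t`-dependent vector fields with values in `V`. -/
def quasiLieFamily {I : Set ℝ} (V : Submodule ℝ (I → ℝ)) : Set (ℝ → I → ℝ) :=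
  {X | IsSmoothTDepField X ∧ ∀ t, X t ∈ V}

/-- The germs at `x₀` of the elements of `V` form a space of the same dimension as `V`: only the
zero element of `V` vanishes on a neighbourhood of `x₀`. -/
def FaithfulAt {I : Set ℝ} (V : Submodule ℝ (I → ℝ)) (x₀ : I) : Prop :=
  ∀ f ∈ V, (∀ᶠ x in 𝓝 x₀, f x = 0) → f = 0

/-- `φ` is a smooth change of variables from the open set `φ.source` onto `φ.target`. -/
def IsChangeOfVariables (φ : OpenPartialHomeomorph ℝ ℝ) : Prop :=
  ContDiffOn ℝ ∞ φ φ.source ∧ ContDiffOn ℝ ∞ φ.symm φ.target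

/-- The `t`-dependent vector field on `φ.target` that describes, in the new variable `y = φ(x)`,
the restriction to `φ.source` of the ODE `dx/dt = X(t,x)`, namely `dy/dt = φ'(x) X(t,x)`. -/
noncomputable def pushforward {I : Set ℝ} (φ : OpenPartialHomeomorph ℝ ℝ) (h : φ.source ⊆ I)
    (X : ℝ → I → ℝ) : ℝ → φ.target → ℝ :=
  fun t y => deriv φ (φ.symm y) * X t ⟨φ.symm y, h (φ.map_target y.2)⟩

/-- `dy/dt = Y(t,y)` is an Abel equation of the first kind and degree `q` on `J`, that is,
`Y(t,y) = a₀(t) + a₁(t) y + ⋯ + a_q(t) y^q` with smooth coefficients (`a_q = 0` is allowed). -/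
def IsAbel {J : Set ℝ} (q : ℕ) (Y : ℝ → J → ℝ) : Prop :=
  ∃ a : Fin (q + 1) → ℝ → ℝ, (∀ k, ContDiff ℝ ∞ (a k)) ∧
    ∀ (t : ℝ) (y : J), Y t y = ∑ k : Fin (q + 1), a k t * (y : ℝ) ^ (k : ℕ)

end QuasiLie

namespace QuasiLie

open Filter Polynomial

/-! ### Blow-up of solutions at a zero of the vector field -/

/-! For a pair `[f, g] = g`, the coordinate `y = -f/g` turns `g` into `∂_y` and `f` into `-y ∂_y`.
Near a point where `W` is faithful and not all of it vanishes, `W` contains such a pair with `g ≠ 0`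
(`exists_affine_pair`). On `V` the relation `[ad f, ad g] = ad g` forces `(ad g)^(q+1) = 0`
(`pow_finrank_eq_zero_of_commutator_eq_self`). Since `ad g` acts on the ratio `h/g` as `d/dy`, each
`h` in `V` is `g` times a polynomial in `y` of degree at most `q`. So `y` gives an Abel equation on
any interval of `I` where `g ≠ 0` (`IsQuasiLieScheme.exists_isAbel`), which settles the local
statement.

The global one needs `g` to have no zero (`IsQuasiLieScheme.extendZero_ne_zero`). By faithfulness
and a dimension count, `A = y^q g` and `B = y^(q-1) g` extend from an interval where `g ≠ 0` to
elements of `V`. At an endpoint `b` with `g b = 0`, `|y|` tends to infinity; since `[B, A] = y^(q-2)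
A` stays bounded and `q ≥ 3`, `A` vanishes at `b`. But `y^(1-q)` has derivative `(1-q)/A`, so it
blows up for the same reason as `y`, although it tends to `0`.

Conversely, polynomials of degree at most `1` and at most `q` in `y = φ(x)` give `W` and `V`. -/

theorem tendsto_atTop_of_div_le_deriv {a b k : ℝ} {p p' : ℝ → ℝ} (hab : a < b) (hk : 0 < k)
    (hp : ∀ x ∈ Ioo a b, HasDerivAt p (p' x) x) (h : ∀ x ∈ Ioo a b, k / (b - x) ≤ p' x) :
    Tendsto p (𝓝[<] b) atTop := by
  have hlog : ∀ x ∈ Ioo a b, HasDerivAt (fun x => k * Real.log (b - x)) (-(k / (b - x))) x := by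
    intro x hx
    have hne : b - x ≠ 0 := (sub_pos.2 hx.2).ne'
    have := (((hasDerivAt_id x).const_sub b).log hne).const_mul k
    convert! this using 1
    simp only [id]
    ring
  have hd : ∀ x ∈ Ioo a b, HasDerivAt (fun x => p x + k * Real.log (b - x))
      (p' x + -(k / (b - x))) x := fun x hx => (hp x hx).add (hlog x hx)
  have hmono : MonotoneOn (fun x => p x + k * Real.log (b - x)) (Ioo a b) := by
    refine monotoneOn_of_deriv_nonneg (convex_Ioo a b)
      (fun x hx => (hd x hx).continuousAt.continuousWithinAt) ?_ ?_
    · rw [interior_Ioo]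
      exact fun x hx => (hd x hx).differentiableAt.differentiableWithinAt
    · rw [interior_Ioo]
      intro x hx
      rw [(hd x hx).deriv]
      linarith [h x hx]
  obtain ⟨m, hm⟩ := exists_between hab
  have hsub : Tendsto (fun x => b - x) (𝓝[<] b) (𝓝[>] 0) := by
    refine tendsto_nhdsWithin_iff.2 ⟨?_, ?_⟩
    · have : Tendsto (fun x => b - x) (𝓝 b) (𝓝 (b - b)) := by
        exact (continuous_const.sub continuous_id).tendsto b
      rw [sub_self] at this
      exact this.mono_left nhdsWithin_le_nhds
    · filter_upwards [self_mem_nhdsWithin] with x hx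
      exact sub_pos.2 (mem_Iio.1 hx)
  have hbot : Tendsto (fun x => p m + k * Real.log (b - m) + (-k) * Real.log (b - x))
      (𝓝[<] b) atTop :=
    tendsto_atTop_add_const_left _ _
      ((Real.tendsto_log_nhdsGT_zero.comp hsub).const_mul_atBot_of_neg (neg_lt_zero.2 hk))
  refine tendsto_atTop_mono' _ ?_ hbot
  filter_upwards [Ioo_mem_nhdsLT hm.2] with x hx
  have := hmono hm ⟨hm.1.trans hx.1, hx.2⟩ hx.1.le
  simp only at this
  linarith

/-- Differentiability at the zero `b` gives `|A x| ≤ C (b - x)` nearby, so `|p'|` dominates a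
multiple of `1/(b - x)` and `p` diverges logarithmically at least; `p'` keeps its sign because it is
continuous and never zero. -/
theorem tendsto_abs_atTop_of_hasDerivAt_div {a b c : ℝ} {p A : ℝ → ℝ} (hab : a < b) (hc : c ≠ 0)
    (hA0 : ∀ x ∈ Ioo a b, A x ≠ 0) (hAc : ContinuousOn A (Ioo a b))
    (hp : ∀ x ∈ Ioo a b, HasDerivAt p (c / A x) x)
    (hAb : A b = 0) (hd : DifferentiableAt ℝ A b) :
    Tendsto (fun x => |p x|) (𝓝[<] b) atTop := by
  obtain ⟨C, hC, hCb⟩ := hd.isBigO_sub.exists_pos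
  have hCb' : ∀ᶠ x in 𝓝[<] b, |A x| ≤ C * |x - b| := by
    have := hCb.bound.filter_mono (nhdsWithin_le_nhds (s := Iio b))
    simpa [hAb] using this
  obtain ⟨l, hl, hlb⟩ := (mem_nhdsLT_iff_exists_Ioo_subset' hab).1 hCb'
  set a' := max a l with ha'
  have ha'b : a' < b := max_lt hab hl
  have hsub : Ioo a' b ⊆ Ioo a b := Ioo_subset_Ioo_left (le_max_left _ _)
  have hbound : ∀ x ∈ Ioo a' b, (|c| / C) / (b - x) ≤ |c / A x| := by
    intro x hx
    have h1 : |A x| ≤ C * |x - b| := hlb ⟨(le_max_right _ _).trans_lt hx.1, hx.2⟩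
    rw [abs_of_neg (sub_neg.2 hx.2), neg_sub] at h1
    rw [abs_div, div_div]
    exact div_le_div_of_nonneg_left (abs_nonneg c) (abs_pos.2 (hA0 x (hsub hx))) h1
  have hk : 0 < |c| / C := div_pos (abs_pos.2 hc) hC
  have hcont : ContinuousOn (fun x => c / A x) (Ioo a' b) :=
    continuousOn_const.div (hAc.mono hsub) fun x hx => hA0 x (hsub hx)
  have hne : ∀ x ∈ Ioo a' b, c / A x ≠ 0 := fun x hx => div_ne_zero hc (hA0 x (hsub hx))
  have hsign : (∀ x ∈ Ioo a' b, 0 < c / A x) ∨ (∀ x ∈ Ioo a' b, c / A x < 0) := by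
    by_contra! hcon
    obtain ⟨⟨x, hx, hx0⟩, z, hz, hz0⟩ := hcon
    obtain ⟨w, hw, hw0⟩ := isPreconnected_Ioo.intermediate_value hx hz hcont ⟨hx0, hz0⟩
    exact hne w hw hw0
  rcases hsign with hs | hs
  · refine tendsto_abs_atTop_atTop.comp (tendsto_atTop_of_div_le_deriv ha'b hk
      (fun x hx => hp x (hsub hx)) fun x hx => ?_)
    have := hbound x hx
    rwa [abs_of_pos (hs x hx)] at this
  · have : Tendsto (fun x => -p x) (𝓝[<] b) atTop :=
      tendsto_atTop_of_div_le_deriv ha'b hk (fun x hx => (hp x (hsub hx)).neg) fun x hx => by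
        have := hbound x hx
        rwa [abs_of_neg (hs x hx)] at this
    simpa [Function.comp_def] using tendsto_abs_atTop_atTop.comp this

/-- If `y' = 1 / g` to the left of a zero `b` of `g`, then the fields `y ^ (m + 2) g` and
`y ^ (m + 3) g` do not both extend smoothly to `b`. -/
theorem false_of_smooth_of_zero_left {a b : ℝ} {m : ℕ} {U : Set ℝ} {g y A B : ℝ → ℝ}
    (hab : a < b) (hU : IsOpen U) (hbU : b ∈ U) (haU : Ioo a b ⊆ U)
    (hg : ContDiffOn ℝ ∞ g U) (hA : ContDiffOn ℝ ∞ A U) (hB : ContDiffOn ℝ ∞ B U)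
    (hg0 : ∀ x ∈ Ioo a b, g x ≠ 0) (hgb : g b = 0)
    (hy : ∀ x ∈ Ioo a b, HasDerivAt y (1 / g x) x)
    (hAy : ∀ x ∈ Ioo a b, A x = y x ^ (m + 3) * g x)
    (hBy : ∀ x ∈ Ioo a b, B x = y x ^ (m + 2) * g x) : False := by
  have hdiff : ∀ {F : ℝ → ℝ}, ContDiffOn ℝ ∞ F U → ∀ x ∈ U, DifferentiableAt ℝ F x :=
    fun hF x hx => (hF.contDiffAt (hU.mem_nhds hx)).differentiableAt (by simp)
  have hytop : Tendsto (fun x => |y x|) (𝓝[<] b) atTop :=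
    tendsto_abs_atTop_of_hasDerivAt_div hab one_ne_zero hg0 (hg.continuousOn.mono haU) hy hgb
      (hdiff hg b hbU)
  obtain ⟨l, hl, hlb⟩ := (mem_nhdsLT_iff_exists_Ioo_subset' hab).1 (hytop.eventually_gt_atTop 0)
  set a' := max a l
  have ha'b : a' < b := max_lt hab hl
  have hsub : Ioo a' b ⊆ Ioo a b := Ioo_subset_Ioo_left (le_max_left _ _)
  have hy0 : ∀ x ∈ Ioo a' b, y x ≠ 0 := fun x hx =>
    abs_pos.1 (hlb ⟨(le_max_right _ _).trans_lt hx.1, hx.2⟩)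
  have hA0 : ∀ x ∈ Ioo a' b, A x ≠ 0 := fun x hx => by
    rw [hAy x (hsub hx)]
    exact mul_ne_zero (pow_ne_zero _ (hy0 x hx)) (hg0 x (hsub hx))
  have hcd : ∀ {F : ℝ → ℝ}, ContDiffOn ℝ ∞ F U → ContinuousAt (deriv F) b := fun hF =>
    (hF.continuousOn_deriv_of_isOpen hU (by simp)).continuousAt (hU.mem_nhds hbU)
  have hD : ContinuousAt (fun x => B x * deriv A x - A x * deriv B x) b :=
    ((hdiff hB b hbU).continuousAt.mul (hcd hA)).sub ((hdiff hA b hbU).continuousAt.mul (hcd hB))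
  -- From `A = y B` and `y' = 1/g`, the bracket is `B² / g`. The exponent `m + 1` is positive, which
  -- is where degree at least `3` enters.
  have hDy : ∀ x ∈ Ioo a b, B x * deriv A x - A x * deriv B x = y x ^ (m + 1) * A x := by
    intro x hx
    have hAB : A =ᶠ[𝓝 x] fun z => y z * B z := by
      filter_upwards [Ioo_mem_nhds hx.1 hx.2] with z hz
      rw [hAy z hz, hBy z hz]
      ring
    have hBd := (hdiff hB x (haU hx)).hasDerivAt
    rw [(((hy x hx).mul hBd).congr_of_eventuallyEq hAB).deriv, hAy x hx, hBy x hx]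
    have := hg0 x hx
    field_simp
    ring
  have hpow : ∀ n : ℕ, Tendsto (fun x => (|y x| ^ (n + 1))⁻¹) (𝓝[<] b) (𝓝 0) := fun n =>
    tendsto_inv_atTop_zero.comp ((tendsto_pow_atTop n.succ_ne_zero).comp hytop)
  have hAb : A b = 0 := by
    have h1 := ((hD.tendsto.mono_left (nhdsWithin_le_nhds (s := Iio b))).abs).mul (hpow m)
    rw [mul_zero] at h1
    have h2 : Tendsto (fun x => |A x|) (𝓝[<] b) (𝓝 0) := by
      refine h1.congr' ?_
      filter_upwards [Ioo_mem_nhdsLT ha'b] with x hx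
      rw [hDy x (hsub hx), abs_mul, abs_pow]
      have := abs_ne_zero.2 (hy0 x hx)
      field_simp
    have h3 := ((hdiff hA b hbU).continuousAt.tendsto.mono_left
      (nhdsWithin_le_nhds (s := Iio b))).abs
    exact abs_eq_zero.1 (tendsto_nhds_unique h3 h2)
  -- A negative power of `y` is to `A` what `y` is to `g`, so the blow-up lemma applies a second
  -- time.
  have hv : ∀ x ∈ Ioo a' b, HasDerivAt (fun x => (y x ^ (m + 2))⁻¹) (-((m : ℝ) + 2) / A x) x := by
    intro x hx
    have h0 := hy0 x hx
    have hg0 := hg0 x (hsub hx)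
    have := ((hy x (hsub hx)).fun_pow (m + 2)).inv (pow_ne_zero _ h0)
    convert! this using 1
    rw [hAy x (hsub hx)]
    push_cast
    field_simp
    ring
  have hm : -((m : ℝ) + 2) ≠ 0 := neg_ne_zero.2 (by positivity)
  have hvtop := tendsto_abs_atTop_of_hasDerivAt_div ha'b hm hA0
    (hA.continuousOn.mono (hsub.trans haU)) hv hAb (hdiff hA b hbU)
  refine not_tendsto_nhds_of_tendsto_atTop hvtop 0 ?_
  simpa [abs_inv, abs_pow] using hpow (m + 1)

/-- Reflection `x ↦ -x` of the previous case: vector fields change sign under it, the coordinate `y`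
does not. -/
theorem false_of_smooth_of_zero_right {a b : ℝ} {m : ℕ} {U : Set ℝ} {g y A B : ℝ → ℝ}
    (hab : b < a) (hU : IsOpen U) (hbU : b ∈ U) (haU : Ioo b a ⊆ U)
    (hg : ContDiffOn ℝ ∞ g U) (hA : ContDiffOn ℝ ∞ A U) (hB : ContDiffOn ℝ ∞ B U)
    (hg0 : ∀ x ∈ Ioo b a, g x ≠ 0) (hgb : g b = 0)
    (hy : ∀ x ∈ Ioo b a, HasDerivAt y (1 / g x) x)
    (hAy : ∀ x ∈ Ioo b a, A x = y x ^ (m + 3) * g x)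
    (hBy : ∀ x ∈ Ioo b a, B x = y x ^ (m + 2) * g x) : False := by
  have hmem : ∀ {x}, x ∈ Ioo (-a) (-b) → -x ∈ Ioo b a := fun hx =>
    ⟨by linarith [hx.2], by linarith [hx.1]⟩
  have hneg : ∀ {F : ℝ → ℝ}, ContDiffOn ℝ ∞ F U →
      ContDiffOn ℝ ∞ (fun x => -F (-x)) (Neg.neg ⁻¹' U) := fun hF =>
    (hF.comp contDiff_neg.contDiffOn fun x hx => hx).neg
  refine false_of_smooth_of_zero_left (a := -a) (b := -b) (m := m) (U := Neg.neg ⁻¹' U)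
    (g := fun x => -g (-x)) (y := fun x => y (-x)) (A := fun x => -A (-x)) (B := fun x => -B (-x))
    (neg_lt_neg hab) (hU.preimage continuous_neg) (by simpa using hbU)
    (fun x hx => haU (hmem hx)) (hneg hg) (hneg hA) (hneg hB)
    (fun x hx => neg_ne_zero.2 (hg0 _ (hmem hx))) (by simpa using hgb) ?_ ?_ ?_
  · intro x hx
    have := (hy _ (hmem hx)).comp x (hasDerivAt_neg x)
    convert! this using 1
    rw [div_neg]
    ring
  · intro x hx
    simp only [hAy _ (hmem hx)]
    ring
  · intro x hx
    simp only [hBy _ (hmem hx)]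
    ring

/-! ### Linear algebra and interpolation -/

/-- Each nonzero `T ^ n` is an eigenvector of `ad S` with eigenvalue `n`; a finite-dimensional space
admits only finitely many eigenvalues, so `T` is nilpotent. Cayley–Hamilton then gives the explicit
exponent. -/
theorem pow_finrank_eq_zero_of_commutator_eq_self {E : Type*} [AddCommGroup E] [Module ℝ E]
    [FiniteDimensional ℝ E] {S T : Module.End ℝ E} (h : S * T - T * S = T) :
    T ^ Module.finrank ℝ E = 0 := by
  have hpow : ∀ n : ℕ, S * T ^ n - T ^ n * S = (n : ℝ) • T ^ n := by
    intro n
    induction n with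
    | zero => simp
    | succ n ih =>
      have : S * T ^ (n + 1) - T ^ (n + 1) * S
          = (S * T ^ n - T ^ n * S) * T + T ^ n * (S * T - T * S) := by
        rw [pow_succ]
        noncomm_ring
      rw [this, ih, h, smul_mul_assoc, ← pow_succ]
      push_cast
      rw [add_smul, one_smul]
  have hnil : IsNilpotent T := by
    by_contra hT
    have hne : ∀ n, T ^ n ≠ 0 := fun n hn => hT ⟨n, hn⟩
    let adS : Module.End ℝ (Module.End ℝ E) := LinearMap.mulLeft ℝ S - LinearMap.mulRight ℝ S
    have hev : ∀ n : ℕ, adS.HasEigenvalue (n : ℝ) := fun n =>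
      Module.End.hasEigenvalue_of_hasEigenvector (x := T ^ n)
        ⟨Module.End.mem_eigenspace_iff.2 (by simpa [adS] using hpow n), hne n⟩
    exact Set.infinite_of_injective_forall_mem Nat.cast_injective hev adS.finite_hasEigenvalue
  have := LinearMap.aeval_self_charpoly T
  rwa [hnil.charpoly_eq_X_pow_finrank, map_pow, aeval_X] at this

/-- The coefficients of a family of polynomials of bounded degree are smooth as soon as the values
at infinitely many points are. -/
theorem contDiff_coeff_of_contDiff_eval {n : ℕ} {p : ℝ → ℝ[X]} (hp : ∀ t, (p t).degree < n)
    {s : Set ℝ} (hs : s.Infinite) (h : ∀ y ∈ s, ContDiff ℝ ∞ fun t => (p t).eval y) (k : ℕ) :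
    ContDiff ℝ ∞ fun t => (p t).coeff k := by
  obtain ⟨S, hS, hcard⟩ := hs.exists_subset_card_eq n
  -- With nodes independent of `t`, Lagrange interpolation makes the coefficient a fixed linear
  -- combination of values.
  have hform : ∀ t, (p t).coeff k = ∑ y ∈ S, (p t).eval y * (Lagrange.basis S id y).coeff k := by
    intro t
    have := Lagrange.eq_interpolate (s := S) (v := id) (injOn_id _) (f := p t) (by
      rw [hcard]; exact hp t)
    conv_lhs => rw [this]
    simp [Lagrange.interpolate_apply]
  simp_rw [hform]
  exact ContDiff.sum fun y hy => (h y (hS hy)).mul contDiff_const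

/-! ### Changes of variables on an interval -/

/-- On an interval, Rolle's theorem upgrades a nonvanishing derivative to global injectivity;
openness and smoothness of the inverse are local. -/
theorem exists_isChangeOfVariables {U : Set ℝ} (hU : IsOpen U) (hUc : IsPreconnected U)
    {φ : ℝ → ℝ} (hφ : ContDiffOn ℝ ∞ φ U) (h0 : ∀ x ∈ U, deriv φ x ≠ 0) :
    ∃ e : OpenPartialHomeomorph ℝ ℝ, e.source = U ∧ (e : ℝ → ℝ) = φ ∧ IsChangeOfVariables e := by
  have hat : ∀ x ∈ U, ContDiffAt ℝ ∞ φ x := fun x hx => hφ.contDiffAt (hU.mem_nhds hx)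
  have hlt : ∀ x ∈ U, ∀ z ∈ U, x < z → φ x ≠ φ z := by
    intro x hx z hz hxz heq
    have hsub : Icc x z ⊆ U := hUc.Icc_subset hx hz
    obtain ⟨c, hc, hc0⟩ := exists_deriv_eq_zero hxz (hφ.continuousOn.mono hsub) heq
    exact h0 c (hsub (Ioo_subset_Icc_self hc)) hc0
  have hinj : InjOn φ U := by
    intro x hx z hz heq
    rcases lt_trichotomy x z with h | h | h
    · exact (hlt x hx z hz h heq).elim
    · exact h
    · exact (hlt z hz x hx h heq.symm).elim
  have hopen : IsOpenMap (U.domRestrict φ) := by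
    refine isOpenMap_iff_nhds_le.2 fun x => ?_
    have hs := (hat x x.2).hasStrictDerivAt (by simp)
    rw [show U.domRestrict φ = φ ∘ Subtype.val from rfl, ← Filter.map_map,
      map_nhds_subtype_coe_eq_nhds x.2 (hU.mem_nhds x.2), hs.map_nhds_eq (h0 x x.2)]
    rfl
  let e := OpenPartialHomeomorph.ofContinuousOpenRestrict (hinj.bijOn_image.toPartialEquiv φ U _)
    hφ.continuousOn hopen hU
  refine ⟨e, rfl, rfl, hφ, ?_⟩
  intro z hz
  have hz' : e.symm z ∈ U := e.map_target hz
  refine (e.contDiffAt_symm_deriv (h0 _ hz') hz ?_ (hat _ hz')).contDiffWithinAt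
  exact ((hat _ hz').differentiableAt (by simp)).hasDerivAt

theorem IsChangeOfVariables.deriv_ne_zero {φ : OpenPartialHomeomorph ℝ ℝ}
    (h : IsChangeOfVariables φ) {x : ℝ} (hx : x ∈ φ.source) : deriv φ x ≠ 0 := by
  have h1 : HasDerivAt φ (deriv φ x) x :=
    ((h.1.contDiffAt (φ.open_source.mem_nhds hx)).differentiableAt (by simp)).hasDerivAt
  have h2 := ((h.2.contDiffAt (φ.open_target.mem_nhds (φ.map_source hx))).differentiableAt
    (by simp)).hasDerivAt
  have h3 := (h2.comp x h1).congr_of_eventuallyEq (f₁ := id) (by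
    filter_upwards [φ.open_source.mem_nhds hx] with z hz
    exact (φ.left_inv hz).symm)
  intro h0
  rw [h0, mul_zero] at h3
  exact zero_ne_one (h3.unique (hasDerivAt_id x))

/-! ### The Lie algebra of smooth vector fields -/

variable {I : Set ℝ}

theorem extendZero_of_mem (f : I → ℝ) {x : ℝ} (hx : x ∈ I) : extendZero f x = f ⟨x, hx⟩ :=
  extendZero_apply f ⟨x, hx⟩

theorem extendZero_of_notMem (f : I → ℝ) {x : ℝ} (hx : x ∉ I) : extendZero f x = 0 :=
  Function.extend_apply' _ _ _ fun ⟨z, hz⟩ => hx (hz ▸ z.2)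

theorem extendZero_add (f g : I → ℝ) : extendZero (f + g) = extendZero f + extendZero g := by
  ext x
  by_cases hx : x ∈ I
  · simp [extendZero_of_mem _ hx]
  · simp [extendZero_of_notMem _ hx]

theorem extendZero_smul (c : ℝ) (f : I → ℝ) : extendZero (c • f) = c • extendZero f := by
  ext x
  by_cases hx : x ∈ I
  · simp [extendZero_of_mem _ hx]
  · simp [extendZero_of_notMem _ hx]

theorem extendZero_bracket (f g : I → ℝ) {x : ℝ} (hx : x ∈ I) :
    extendZero (bracket f g) x = extendZero f x * deriv (extendZero g) x
      - extendZero g x * deriv (extendZero f) x := by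
  rw [extendZero_of_mem _ hx, bracket_apply, extendZero_of_mem _ hx, extendZero_of_mem _ hx]

theorem IsSmoothField.contDiffAt {f : I → ℝ} (hf : IsSmoothField f) (hI : IsOpen I) {x : ℝ}
    (hx : x ∈ I) : ContDiffAt ℝ ∞ (extendZero f) x :=
  ContDiffOn.contDiffAt hf (hI.mem_nhds hx)

theorem IsSmoothField.differentiableAt {f : I → ℝ} (hf : IsSmoothField f) (hI : IsOpen I) {x : ℝ}
    (hx : x ∈ I) : DifferentiableAt ℝ (extendZero f) x :=
  (hf.contDiffAt hI hx).differentiableAt (by simp)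

theorem IsSmoothField.contDiffOn_deriv {f : I → ℝ} (hf : IsSmoothField f) (hI : IsOpen I) :
    ContDiffOn ℝ ∞ (deriv (extendZero f)) I :=
  ContDiffOn.deriv_of_isOpen hf hI (by simp)

theorem IsSmoothField.differentiableAt_deriv {f : I → ℝ} (hf : IsSmoothField f) (hI : IsOpen I)
    {x : ℝ} (hx : x ∈ I) : DifferentiableAt ℝ (deriv (extendZero f)) x :=
  ((hf.contDiffOn_deriv hI).contDiffAt (hI.mem_nhds hx)).differentiableAt (by simp)

theorem IsSmoothField.bracket {f g : I → ℝ} (hf : IsSmoothField f) (hg : IsSmoothField g)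
    (hI : IsOpen I) : IsSmoothField (bracket f g) :=
  ((ContDiffOn.mul hf (hg.contDiffOn_deriv hI)).sub
    (ContDiffOn.mul hg (hf.contDiffOn_deriv hI))).congr fun _ hx => extendZero_bracket f g hx

theorem bracket_add_right (hI : IsOpen I) (f : I → ℝ) {g h : I → ℝ} (hg : IsSmoothField g)
    (hh : IsSmoothField h) : bracket f (g + h) = bracket f g + bracket f h := by
  ext x
  simp only [Pi.add_apply, bracket_apply, extendZero_add,
    deriv_add (hg.differentiableAt hI x.2) (hh.differentiableAt hI x.2)]
  ring

theorem bracket_smul_right (c : ℝ) (f g : I → ℝ) : bracket f (c • g) = c • bracket f g := by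
  ext x
  simp only [Pi.smul_apply, bracket_apply, extendZero_smul, smul_eq_mul, deriv_const_smul_field]
  ring

theorem bracket_comm (f g : I → ℝ) : bracket g f = -bracket f g := by
  ext x
  simp only [Pi.neg_apply, bracket_apply]
  ring

theorem bracket_self (f : I → ℝ) : bracket f f = 0 := by
  ext x
  simp [bracket_apply]

theorem bracket_smul_left (c : ℝ) (f g : I → ℝ) : bracket (c • f) g = c • bracket f g := by
  rw [bracket_comm g, bracket_smul_right, bracket_comm f g, smul_neg, neg_neg]

theorem bracket_jacobi (hI : IsOpen I) {f g h : I → ℝ} (hf : IsSmoothField f)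
    (hg : IsSmoothField g) (hh : IsSmoothField h) :
    bracket f (bracket g h) - bracket g (bracket f h) = bracket (bracket f g) h := by
  have key : ∀ {u v : I → ℝ}, IsSmoothField u → IsSmoothField v → ∀ x : I,
      deriv (extendZero (bracket u v)) x = u x * deriv (deriv (extendZero v)) x
        - v x * deriv (deriv (extendZero u)) x := by
    intro u v hu hv x
    have h1 : extendZero (bracket u v) =ᶠ[𝓝 (x : ℝ)] fun z =>
        extendZero u z * deriv (extendZero v) z - extendZero v z * deriv (extendZero u) z := by
      filter_upwards [hI.mem_nhds x.2] with z hz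
      exact extendZero_bracket u v hz
    have h2 := ((hu.differentiableAt hI x.2).hasDerivAt.mul
      (hv.differentiableAt_deriv hI x.2).hasDerivAt).sub
      ((hv.differentiableAt hI x.2).hasDerivAt.mul (hu.differentiableAt_deriv hI x.2).hasDerivAt)
    rw [(h2.congr_of_eventuallyEq h1).deriv, extendZero_apply, extendZero_apply]
    ring
  ext x
  simp only [Pi.sub_apply, bracket_apply (x := x), key hf hg, key hg hh, key hf hh]
  ring

/-- Equivalently `[g, f]/g = g · (f/g)'`: where `y' = 1/g`, bracketing with `g` differentiates the
ratio with respect to `y`. -/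
theorem hasDerivAt_extendZero_div (hI : IsOpen I) {f g : I → ℝ} (hf : IsSmoothField f)
    (hg : IsSmoothField g) {x : ℝ} (hx : x ∈ I) (h0 : extendZero g x ≠ 0) :
    HasDerivAt (fun z => extendZero f z / extendZero g z)
      (extendZero (bracket g f) x / extendZero g x ^ 2) x := by
  have := (hf.differentiableAt hI hx).hasDerivAt.fun_div (hg.differentiableAt hI hx).hasDerivAt h0
  convert! this using 2
  rw [extendZero_bracket _ _ hx]
  ring

theorem IsSmoothField.eventually_ne {g : I → ℝ} (hg : IsSmoothField g) (hI : IsOpen I) {x : ℝ}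
    (hx : x ∈ I) (h0 : extendZero g x ≠ 0) : ∀ᶠ z in 𝓝 x, z ∈ I ∧ extendZero g z ≠ 0 :=
  (show ∀ᶠ z in 𝓝 x, z ∈ I from hI.mem_nhds hx).and
    ((hg.differentiableAt hI hx).continuousAt.eventually_ne h0)

theorem eventually_subtype_nhds (hI : IsOpen I) (x₀ : I) {f : I → ℝ} :
    (∀ᶠ x in 𝓝 x₀, f x = 0) ↔ ∀ᶠ x in 𝓝 (x₀ : ℝ), extendZero f x = 0 := by
  rw [← map_nhds_subtype_coe_eq_nhds x₀.2 (hI.mem_nhds x₀.2), eventually_map]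
  simp [extendZero_apply]

theorem FaithfulAt.mono {W V : Submodule ℝ (I → ℝ)} {x₀ : I} (h : FaithfulAt V x₀) (hle : W ≤ V) :
    FaithfulAt W x₀ := fun f hf => h f (hle hf)

theorem eventually_eq_zero_of_hasDerivAt_mul {c r : ℝ → ℝ} {x₀ : ℝ} (hc : ContinuousAt c x₀)
    (hr : ∀ᶠ x in 𝓝 x₀, HasDerivAt r (c x * r x) x) (h0 : r x₀ = 0) :
    ∀ᶠ x in 𝓝 x₀, r x = 0 := by
  have hK : ∀ᶠ x in 𝓝 x₀, ‖c x‖ < ‖c x₀‖ + 1 :=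
    hc.norm.eventually_lt continuousAt_const (lt_add_one _)
  obtain ⟨a, b, hx₀, hab⟩ := mem_nhds_iff_exists_Ioo_subset.1 (hr.and hK)
  have := ODE_solution_unique_of_mem_Ioo (v := fun x z => c x * z) (s := fun _ => univ)
    (K := ⟨‖c x₀‖ + 1, by positivity⟩) (f := r) (g := 0) (t₀ := x₀) (a := a) (b := b) ?_ hx₀
    (fun x hx => ⟨(hab hx).1, mem_univ _⟩) (fun x _ => ⟨?_, mem_univ _⟩) (by simpa using h0)
  · filter_upwards [Ioo_mem_nhds hx₀.1 hx₀.2] with x hx using this hx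
  · intro x hx
    refine LipschitzOnWith.of_dist_le_mul fun u _ v _ => ?_
    rw [Real.dist_eq, Real.dist_eq, ← mul_sub, abs_mul]
    exact mul_le_mul_of_nonneg_right (hab hx).2.le (abs_nonneg _)
  · simp

/-! ### The two-dimensional algebra `W` -/

/-- A two-dimensional algebra of vector fields on the line which is faithful and does not vanish
at `x₀` contains an affine pair `[f, g] = g` with `g x₀ ≠ 0`. -/
theorem exists_affine_pair (hI : IsOpen I) {W : Submodule ℝ (I → ℝ)}
    (hs : ∀ f ∈ W, IsSmoothField f) (hb : ∀ f ∈ W, ∀ g ∈ W, bracket f g ∈ W)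
    (hW : Module.finrank ℝ W = 2) {x₀ : I} (hf : FaithfulAt W x₀) {w : I → ℝ} (hw : w ∈ W)
    (hw0 : w x₀ ≠ 0) : ∃ f ∈ W, ∃ g ∈ W, bracket f g = g ∧ g x₀ ≠ 0 := by
  have hwn : ∀ᶠ z in 𝓝 (x₀ : ℝ), z ∈ I ∧ extendZero w z ≠ 0 :=
    (hs w hw).eventually_ne hI x₀.2 (by rwa [extendZero_apply])
  -- If `w` commuted with `W`, every ratio `e/w` would be constant near `x₀`, and faithfulness would
  -- make `W` one-dimensional.
  obtain ⟨e, he, hwe⟩ : ∃ e ∈ W, bracket w e ≠ 0 := by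
    by_contra! hcon
    have hle : W ≤ Submodule.span ℝ {w} := by
      intro e he
      rw [Submodule.mem_span_singleton]
      obtain ⟨a, b, hx₀, hab⟩ := mem_nhds_iff_exists_Ioo_subset.1 hwn
      have hd : ∀ x ∈ Ioo a b, HasDerivAt (fun z => extendZero e z / extendZero w z) 0 x := by
        intro x hx
        have := hasDerivAt_extendZero_div hI (hs e he) (hs w hw) (hab hx).1 (hab hx).2
        rw [hcon e he] at this
        simpa [extendZero_of_mem _ (hab hx).1] using this
      obtain ⟨c, hc⟩ := isOpen_Ioo.exists_is_const_of_deriv_eq_zero isPreconnected_Ioo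
        (fun x hx => (hd x hx).differentiableAt.differentiableWithinAt)
        (fun x hx => (hd x hx).deriv)
      refine ⟨c, ?_⟩
      have := hf (c • w + (-1 : ℝ) • e) (W.add_mem (W.smul_mem _ hw) (W.smul_mem _ he)) (by
        rw [eventually_subtype_nhds hI]
        filter_upwards [Ioo_mem_nhds hx₀.1 hx₀.2] with x hx
        have h1 := hc x hx
        have h2 := (hab hx).2
        rw [extendZero_add, extendZero_smul, extendZero_smul]
        simp only [Pi.add_apply, Pi.smul_apply, smul_eq_mul]
        rw [← h1]
        field_simp
        ring)
      rwa [neg_smul, one_smul, ← sub_eq_add_neg, sub_eq_zero] at this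
    have h1 := Submodule.finrank_mono hle
    have h2 := finrank_span_le_card (R := ℝ) ({w} : Set (I → ℝ))
    simp at h2
    omega
  have hind : LinearIndependent ℝ ![(⟨w, hw⟩ : W), ⟨e, he⟩] := by
    rw [LinearIndependent.pair_iff]
    intro s t hst
    have hst' : s • w + t • e = 0 := congrArg Subtype.val hst
    have h1 : bracket w (s • w + t • e) = t • bracket w e := by
      rw [bracket_add_right hI _ (hs _ (W.smul_mem _ hw)) (hs _ (W.smul_mem _ he)),
        bracket_smul_right, bracket_smul_right, bracket_self, smul_zero, zero_add]
    have h2 : bracket w 0 = 0 := by simpa using bracket_smul_right 0 w 0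
    rw [hst', h2] at h1
    have ht : t = 0 := (smul_eq_zero.1 h1.symm).resolve_right hwe
    rw [ht, zero_smul, add_zero] at hst'
    refine ⟨(smul_eq_zero.1 hst').resolve_right fun h => hw0 ?_, ht⟩
    rw [h, Pi.zero_apply]
  have hspan := hind.span_eq_top_of_card_eq_finrank (by rw [hW]; simp)
  set g := bracket w e with hg
  have hgW : g ∈ W := hb w hw e he
  obtain ⟨α, β, hαβ⟩ : ∃ α β : ℝ, α • w + β • e = g := by
    have : (⟨g, hgW⟩ : W) ∈ Submodule.span ℝ (range ![(⟨w, hw⟩ : W), ⟨e, he⟩]) := by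
      rw [hspan]; trivial
    rw [Matrix.range_cons, Matrix.range_cons, Matrix.range_empty, union_empty, singleton_union,
      Submodule.mem_span_pair] at this
    obtain ⟨α, β, h⟩ := this
    exact ⟨α, β, congrArg Subtype.val h⟩
  have hbr : ∀ u, bracket u g = α • bracket u w + β • bracket u e := by
    intro u
    rw [← hαβ, bracket_add_right hI _ (hs _ (W.smul_mem _ hw)) (hs _ (W.smul_mem _ he)),
        bracket_smul_right, bracket_smul_right]
  have hwg : bracket w g = β • g := by rw [hbr w, bracket_self, smul_zero, zero_add]
  have heg : bracket e g = -α • g := by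
    rw [hbr e, bracket_self, smul_zero, add_zero, bracket_comm w e, smul_neg, neg_smul]
  -- The ratio `g/w` solves a linear homogeneous equation, so a zero at `x₀` would spread to a
  -- neighbourhood and contradict faithfulness.
  have hg0 : g x₀ ≠ 0 := by
    intro h0
    have hr : ∀ᶠ x in 𝓝 (x₀ : ℝ), HasDerivAt (fun z => extendZero g z / extendZero w z)
        (β / extendZero w x * (extendZero g x / extendZero w x)) x := by
      filter_upwards [hwn] with x hx
      have := hasDerivAt_extendZero_div hI (hs g hgW) (hs w hw) hx.1 hx.2
      rw [hwg, extendZero_smul] at this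
      convert! this using 1
      have := hx.2
      simp only [Pi.smul_apply, smul_eq_mul]
      field_simp
    have hz := eventually_eq_zero_of_hasDerivAt_mul (c := fun x => β / extendZero w x)
      (continuousAt_const.div ((hs w hw).differentiableAt hI x₀.2).continuousAt hwn.self_of_nhds.2)
      hr (by simp [extendZero_apply, h0])
    refine hwe (hf g hgW ?_)
    rw [eventually_subtype_nhds hI]
    filter_upwards [hz, hwn] with x hx hx'
    exact (div_eq_zero_iff.1 hx).resolve_right hx'.2
  -- As `g = α w + β e` is nonzero, `w` or `e` acts on it by a nonzero scalar (`β`, respectively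
  -- `-α`), which is normalised to `1`.
  by_cases hβ : β = 0
  · have hα : -α ≠ 0 := by
      rintro hα
      rw [neg_eq_zero] at hα
      rw [hα, hβ, zero_smul, zero_smul, add_zero] at hαβ
      exact hwe hαβ.symm
    exact ⟨(-α)⁻¹ • e, W.smul_mem _ he, g, hgW, by
      rw [bracket_smul_left, heg, inv_smul_smul₀ hα], hg0⟩
  · exact ⟨β⁻¹ • w, W.smul_mem _ hw, g, hgW, by
      rw [bracket_smul_left, hwg, inv_smul_smul₀ hβ], hg0⟩

/-! ### Polynomial form of the elements of `V` -/

/-- The action of an element of `W` on `V`. -/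
noncomputable def IsQuasiLieScheme.ad {W V : Submodule ℝ (I → ℝ)} (S : IsQuasiLieScheme W V)
    (hI : IsOpen I) (f : W) : Module.End ℝ V where
  toFun h := ⟨bracket f h, S.normalises f f.2 h h.2⟩
  map_add' g h := Subtype.ext
    (bracket_add_right hI _ (S.smooth g g.2) (S.smooth h h.2))
  map_smul' c _ := Subtype.ext (bracket_smul_right c _ _)

/-- The Jacobi identity transports `[f, g] = g` to the operators `ad f`, `ad g` on `V`. -/
theorem IsQuasiLieScheme.iterate_bracket_eq_zero {W V : Submodule ℝ (I → ℝ)}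
    (S : IsQuasiLieScheme W V) (hI : IsOpen I) {f g h : I → ℝ} (hf : f ∈ W) (hg : g ∈ W)
    (hfg : bracket f g = g) (hh : h ∈ V) : (bracket g)^[Module.finrank ℝ V] h = 0 := by
  have := S.finite
  have hsm : ∀ u ∈ W, IsSmoothField u := fun u hu => S.smooth u (S.le hu)
  have hcomm : S.ad hI ⟨f, hf⟩ * S.ad hI ⟨g, hg⟩ - S.ad hI ⟨g, hg⟩ * S.ad hI ⟨f, hf⟩
      = S.ad hI ⟨g, hg⟩ := by
    ext u : 2
    have := bracket_jacobi hI (hsm f hf) (hsm g hg) (S.smooth u u.2)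
    rwa [hfg] at this
  have hpow := pow_finrank_eq_zero_of_commutator_eq_self hcomm
  have hiter : ∀ (n : ℕ) (u : V), ((S.ad hI ⟨g, hg⟩ ^ n) u : I → ℝ) = (bracket g)^[n] u := by
    intro n
    induction n with
    | zero => intro u; rfl
    | succ n ih =>
      intro u
      rw [pow_succ, Module.End.mul_apply, ih, Function.iterate_succ_apply]
      rfl
  rw [← hiter _ ⟨h, hh⟩, hpow]
  rfl

theorem exists_derivative_eq (p : ℝ[X]) {n : ℕ} (hp : p.degree < n) :
    ∃ P : ℝ[X], derivative P = p ∧ P.degree < (n + 1 : ℕ) := by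
  rcases n with _ | n
  · exact ⟨0, by simp_all, by simp⟩
  refine ⟨∑ k ∈ Finset.range (n + 1), C (p.coeff k / (k + 1)) * X ^ (k + 1), ?_, ?_⟩
  · rw [derivative_sum]
    conv_rhs => rw [p.as_sum_range' (n + 1)
      (Nat.lt_succ_of_le (natDegree_le_of_degree_le (Order.lt_succ_iff.1 hp)))]
    refine Finset.sum_congr rfl fun k _ => ?_
    rw [derivative_C_mul_X_pow, ← C_mul_X_pow_eq_monomial]
    congr 2
    push_cast
    field_simp
  · rw [← mem_degreeLT]
    refine Submodule.sum_mem _ fun k hk => mem_degreeLT.2 ((degree_C_mul_X_pow_le _ _).trans_lt ?_)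
    exact_mod_cast Nat.succ_lt_succ (Finset.mem_range.1 hk)

/-- The hypothesis says that the `n`-th `y`-derivative of `h/g` vanishes; integrate `n` times, each
constant being global because `U` is connected. -/
theorem exists_polynomial_of_iterate_bracket_eq_zero (hI : IsOpen I) {g : I → ℝ}
    (hg : IsSmoothField g) {U : Set ℝ} (hU : IsOpen U) (hUc : IsPreconnected U) (hUI : U ⊆ I)
    (hg0 : ∀ x ∈ U, extendZero g x ≠ 0) {y : ℝ → ℝ}
    (hy : ∀ x ∈ U, HasDerivAt y (1 / extendZero g x) x) (n : ℕ) {h : I → ℝ}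
    (hh : IsSmoothField h) (hn : (bracket g)^[n] h = 0) :
    ∃ p : ℝ[X], p.degree < n ∧ ∀ x ∈ U, extendZero h x = p.eval (y x) * extendZero g x := by
  induction n generalizing h with
  | zero =>
    refine ⟨0, by simp, fun x hx => ?_⟩
    rw [Function.iterate_zero, id] at hn
    simp [hn, extendZero_of_mem _ (hUI hx)]
  | succ n ih =>
    obtain ⟨p, hp, hpe⟩ := ih (hg.bracket hh hI) hn
    obtain ⟨P, hP, hPd⟩ := exists_derivative_eq p hp
    have hd : ∀ x ∈ U, HasDerivAt (fun z => extendZero h z / extendZero g z - P.eval (y z)) 0 x := by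
      intro x hx
      have h1 := (hasDerivAt_extendZero_div hI hh hg (hUI hx) (hg0 x hx)).sub
        ((P.hasDerivAt (y x)).comp x (hy x hx))
      convert! h1 using 1
      rw [hpe x hx, hP]
      have := hg0 x hx
      field_simp
      ring
    obtain ⟨c, hc⟩ := hU.exists_is_const_of_deriv_eq_zero hUc
      (fun x hx => (hd x hx).differentiableAt.differentiableWithinAt) (fun x hx => (hd x hx).deriv)
    refine ⟨P + C c, ?_, fun x hx => ?_⟩
    · refine (degree_add_le _ _).trans_lt (max_lt hPd (degree_C_le.trans_lt ?_))
      exact_mod_cast n.succ_pos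
    · have := hg0 x hx
      rw [eval_add, eval_C, ← hc x hx]
      field_simp
      ring

/-! ### From schemes to Abel equations -/

/-- The affine coordinate `y = -f / g` of a pair `[f, g] = g`. -/
theorem hasDerivAt_affine_coordinate (hI : IsOpen I) {f g : I → ℝ} (hf : IsSmoothField f)
    (hg : IsSmoothField g) (hfg : bracket f g = g) {x : ℝ} (hx : x ∈ I)
    (h0 : extendZero g x ≠ 0) :
    HasDerivAt (fun z => -(extendZero f z / extendZero g z)) (1 / extendZero g x) x := by
  have := (hasDerivAt_extendZero_div hI hf hg hx h0).neg
  rw [bracket_comm f g, hfg] at this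
  convert! this using 1
  rw [extendZero_of_mem _ hx] at h0 ⊢
  rw [extendZero_of_mem _ hx, Pi.neg_apply]
  field_simp

theorem IsQuasiLieScheme.exists_polynomial {W V : Submodule ℝ (I → ℝ)}
    (S : IsQuasiLieScheme W V) (hI : IsOpen I) {f g : I → ℝ} (hf : f ∈ W) (hg : g ∈ W)
    (hfg : bracket f g = g) {n : ℕ} (hV : Module.finrank ℝ V = n) {U : Set ℝ} (hU : IsOpen U)
    (hUc : IsPreconnected U) (hUI : U ⊆ I) (hg0 : ∀ x ∈ U, extendZero g x ≠ 0)
    {h : I → ℝ} (hh : h ∈ V) :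
    ∃ p : ℝ[X], p.degree < n ∧ ∀ x ∈ U,
      extendZero h x = p.eval (-(extendZero f x / extendZero g x)) * extendZero g x := by
  refine exists_polynomial_of_iterate_bracket_eq_zero hI (S.smooth g (S.le hg)) hU hUc hUI hg0
    (fun x hx => hasDerivAt_affine_coordinate hI (S.smooth f (S.le hf)) (S.smooth g (S.le hg)) hfg
      (hUI hx) (hg0 x hx)) n (S.smooth h hh) ?_
  rw [← hV]
  exact S.iterate_bracket_eq_zero hI hf hg hfg hh

theorem IsQuasiLieScheme.exists_isAbel {W V : Submodule ℝ (I → ℝ)} (S : IsQuasiLieScheme W V)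
    (hI : IsOpen I) {f g : I → ℝ} (hf : f ∈ W) (hg : g ∈ W) (hfg : bracket f g = g) {q : ℕ}
    (hV : Module.finrank ℝ V = q + 1) {X : ℝ → I → ℝ} (hX : X ∈ quasiLieFamily V)
    {U : Set ℝ} (hU : IsOpen U) (hUc : IsConnected U) (hUI : U ⊆ I)
    (hg0 : ∀ x ∈ U, extendZero g x ≠ 0) :
    ∃ (φ : OpenPartialHomeomorph ℝ ℝ) (h : φ.source ⊆ I), φ.source = U ∧
      IsChangeOfVariables φ ∧ IsAbel q (pushforward φ h X) := by
  have hfs := S.smooth f (S.le hf)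
  have hgs := S.smooth g (S.le hg)
  have hy : ∀ x ∈ U, HasDerivAt (fun z => -(extendZero f z / extendZero g z))
      (1 / extendZero g x) x := fun x hx =>
    hasDerivAt_affine_coordinate hI hfs hgs hfg (hUI hx) (hg0 x hx)
  obtain ⟨φ, hφU, hφ, hφc⟩ := exists_isChangeOfVariables hU hUc.isPreconnected
    (φ := fun z => -(extendZero f z / extendZero g z))
    (((ContDiffOn.mono hfs hUI).div (ContDiffOn.mono hgs hUI) hg0).neg)
    (fun x hx => by
      rw [(hy x hx).deriv]
      exact one_div_ne_zero (hg0 x hx))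
  refine ⟨φ, hφU ▸ hUI, hφU, hφc, ?_⟩
  choose p hp hpe using fun t =>
    S.exists_polynomial hI hf hg hfg hV hU hUc.isPreconnected hUI hg0 (hX.2 t)
  replace hpe : ∀ t, ∀ x ∈ U, extendZero (X t) x = (p t).eval (φ x) * extendZero g x := by
    rw [hφ]
    exact hpe
  refine ⟨fun k t => (p t).coeff k, fun k => ?_, fun t z => ?_⟩
  · have hinf : U.Infinite := infinite_of_mem_nhds _ (hU.mem_nhds hUc.nonempty.some_mem)
    -- For fixed `x`, the value of the polynomial at `φ x` is `X(t,x)/g(x)`, smooth in `t`.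
    refine contDiff_coeff_of_contDiff_eval hp (hinf.image (hφU ▸ φ.injOn)) ?_ k
    rintro _ ⟨x, hx, rfl⟩
    have h1 : ∀ t, (p t).eval (φ x) = extendZero (X t) x / extendZero g x := fun t => by
      rw [hpe t x hx, mul_div_cancel_right₀ _ (hg0 x hx)]
    simp_rw [h1]
    have h2 : ContDiffOn ℝ ∞ (fun t : ℝ => extendZero (X t) x) univ :=
      ContDiffOn.comp hX.1 (f := fun t : ℝ => (t, x))
        (contDiff_id.prodMk contDiff_const).contDiffOn fun t _ => ⟨mem_univ _, hUI hx⟩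
    exact (contDiffOn_univ.1 h2).div_const _
  · have hx : φ.symm z ∈ U := hφU ▸ φ.map_target z.2
    have h1 : deriv φ (φ.symm z) = 1 / extendZero g (φ.symm z) := by
      rw [hφ]
      exact (hy _ hx).deriv
    have h2 := hg0 _ hx
    have h3 : (p t).natDegree < q + 1 :=
      Nat.lt_succ_of_le (natDegree_le_of_degree_le (Order.lt_succ_iff.1 (hp t)))
    rw [pushforward, h1, ← extendZero_of_mem (X t), hpe t _ hx, φ.right_inv z.2,
      eval_eq_sum_range' h3, Finset.sum_range]
    field_simp

/-! ### Absence of zeros -/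

/-- Faithfulness makes restriction to `U` injective on `V`; its image lies in a space of dimension
at most `n = dim V`, hence fills it. -/
theorem IsQuasiLieScheme.exists_mem_eq_polynomial {W V : Submodule ℝ (I → ℝ)}
    (S : IsQuasiLieScheme W V) (hI : IsOpen I) {f g : I → ℝ} (hf : f ∈ W) (hg : g ∈ W)
    (hfg : bracket f g = g) {n : ℕ} (hV : Module.finrank ℝ V = n)
    (hfaith : ∀ x₀ : I, FaithfulAt V x₀) {U : Set ℝ} (hU : IsOpen U)
    (hUc : IsConnected U) (hUI : U ⊆ I) (hg0 : ∀ x ∈ U, extendZero g x ≠ 0)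
    {p : ℝ[X]} (hp : p.degree < n) :
    ∃ h ∈ V, ∀ x ∈ U,
      extendZero h x = p.eval (-(extendZero f x / extendZero g x)) * extendZero g x := by
  let R : V →ₗ[ℝ] (U → ℝ) := LinearMap.funLeft ℝ ℝ (inclusion hUI) ∘ₗ V.subtype
  let P : ℝ[X] →ₗ[ℝ] (U → ℝ) :=
    { toFun := fun p x => p.eval (-(extendZero f x / extendZero g x)) * extendZero g x
      map_add' := fun p r => by ext x; simp [add_mul]
      map_smul' := fun c p => by ext x; simp [mul_assoc] }
  have hR : ∀ (h : V) (x : U), R h x = extendZero (h : I → ℝ) x := fun h x =>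
    (extendZero_of_mem _ (hUI x.2)).symm
  have hRinj : Function.Injective R := by
    rw [← LinearMap.ker_eq_bot, LinearMap.ker_eq_bot']
    intro h h0
    obtain ⟨x₀, hx₀⟩ := hUc.nonempty
    refine Subtype.ext (hfaith ⟨x₀, hUI hx₀⟩ h h.2 ?_)
    rw [eventually_subtype_nhds hI]
    filter_upwards [hU.mem_nhds hx₀] with x hx
    rw [← hR h ⟨x, hx⟩, h0, Pi.zero_apply]
  have hle : LinearMap.range R ≤ (degreeLT ℝ n).map P := by
    rintro _ ⟨h, rfl⟩
    obtain ⟨p, hp, hpe⟩ := S.exists_polynomial hI hf hg hfg hV hU hUc.isPreconnected hUI hg0 h.2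
    refine ⟨p, mem_degreeLT.2 hp, ?_⟩
    ext x
    rw [hR, hpe x x.2]
    rfl
  have : FiniteDimensional ℝ (degreeLT ℝ n) := (degreeLTEquiv ℝ n).symm.finiteDimensional
  have heq : LinearMap.range R = (degreeLT ℝ n).map P := by
    refine Submodule.eq_of_le_of_finrank_le hle ?_
    rw [LinearMap.finrank_range_of_inj hRinj, hV]
    refine (Submodule.finrank_map_le P _).trans ?_
    rw [(degreeLTEquiv ℝ n).finrank_eq]
    simp
  obtain ⟨h, hh⟩ : P p ∈ LinearMap.range R := heq ▸ ⟨p, mem_degreeLT.2 hp, rfl⟩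
  refine ⟨h, h.2, fun x hx => ?_⟩
  rw [← hR h ⟨x, hx⟩, hh]
  rfl

/-- Apply the blow-up contradiction at the zero of `g` nearest to `x₁` on either side, which exists
by compactness. -/
theorem IsQuasiLieScheme.extendZero_ne_zero {W V : Submodule ℝ (I → ℝ)}
    (S : IsQuasiLieScheme W V) (hI : IsOpen I) (hIc : IsPreconnected I) {f g : I → ℝ}
    (hf : f ∈ W) (hg : g ∈ W) (hfg : bracket f g = g) {q : ℕ} (hq : 3 ≤ q)
    (hV : Module.finrank ℝ V = q + 1) (hfaith : ∀ x₀ : I, FaithfulAt V x₀) {x₁ : ℝ} (hx₁ : x₁ ∈ I)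
    (hgx₁ : extendZero g x₁ ≠ 0) : ∀ x ∈ I, extendZero g x ≠ 0 := by
  obtain ⟨m, rfl⟩ := Nat.exists_eq_add_of_le' hq
  have hfs := S.smooth f (S.le hf)
  have hgs := S.smooth g (S.le hg)
  have hrep : ∀ {a b : ℝ}, a < b → Ioo a b ⊆ I → (∀ x ∈ Ioo a b, extendZero g x ≠ 0) →
      ∀ k < m + 3 + 1, ∃ h ∈ V, ∀ x ∈ Ioo a b,
        extendZero h x = (-(extendZero f x / extendZero g x)) ^ k * extendZero g x := by
    intro a b hab hsub h0 k hk
    simpa using S.exists_mem_eq_polynomial hI hf hg hfg hV hfaith isOpen_Ioo (isConnected_Ioo hab)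
      hsub h0 (p := X ^ k) (by rw [degree_X_pow]; exact_mod_cast hk)
  have hcont : ∀ {a b : ℝ}, Icc a b ⊆ I → IsCompact {x ∈ Icc a b | extendZero g x = 0} :=
    fun hsub => isCompact_Icc.of_isClosed_subset
      ((ContinuousOn.mono (ContDiffOn.continuousOn hgs) hsub).preimage_isClosed_of_isClosed
        isClosed_Icc isClosed_singleton) (sep_subset _ _)
  intro z hz hgz
  rcases lt_trichotomy x₁ z with h | h | h
  · have hsub : Icc x₁ z ⊆ I := hIc.Icc_subset hx₁ hz
    obtain ⟨b, ⟨hb, hgb⟩, hbl⟩ := (hcont hsub).exists_isLeast ⟨z, ⟨h.le, le_rfl⟩, hgz⟩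
    have hab : x₁ < b := hb.1.lt_of_ne fun h => hgx₁ (h ▸ hgb)
    have hIoo : Ioo x₁ b ⊆ I := fun x hx => hsub ⟨hx.1.le, hx.2.le.trans hb.2⟩
    have h0 : ∀ x ∈ Ioo x₁ b, extendZero g x ≠ 0 := fun x hx h =>
      (hbl ⟨⟨hx.1.le, hx.2.le.trans hb.2⟩, h⟩).not_gt hx.2
    obtain ⟨A, hA, hAe⟩ := hrep hab hIoo h0 (m + 3) (by omega)
    obtain ⟨B, hB, hBe⟩ := hrep hab hIoo h0 (m + 2) (by omega)
    exact false_of_smooth_of_zero_left hab hI (hsub hb) hIoo hgs (S.smooth A hA) (S.smooth B hB)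
      h0 hgb (fun x hx => hasDerivAt_affine_coordinate hI hfs hgs hfg (hIoo hx) (h0 x hx)) hAe hBe
  · exact hgx₁ (h ▸ hgz)
  · have hsub : Icc z x₁ ⊆ I := hIc.Icc_subset hz hx₁
    obtain ⟨b, ⟨hb, hgb⟩, hbl⟩ := (hcont hsub).exists_isGreatest ⟨z, ⟨le_rfl, h.le⟩, hgz⟩
    have hab : b < x₁ := hb.2.lt_of_ne fun h => hgx₁ (h ▸ hgb)
    have hIoo : Ioo b x₁ ⊆ I := fun x hx => hsub ⟨hb.1.trans hx.1.le, hx.2.le⟩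
    have h0 : ∀ x ∈ Ioo b x₁, extendZero g x ≠ 0 := fun x hx h =>
      (hbl ⟨⟨hb.1.trans hx.1.le, hx.2.le⟩, h⟩).not_gt hx.1
    obtain ⟨A, hA, hAe⟩ := hrep hab hIoo h0 (m + 3) (by omega)
    obtain ⟨B, hB, hBe⟩ := hrep hab hIoo h0 (m + 2) (by omega)
    exact false_of_smooth_of_zero_right hab hI (hsub hb) hIoo hgs (S.smooth A hA) (S.smooth B hB)
      h0 hgb (fun x hx => hasDerivAt_affine_coordinate hI hfs hgs hfg (hIoo hx) (h0 x hx)) hAe hBe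

/-! ### From Abel equations to schemes -/

/-- The vector field on `I` which is `p(y) ∂/∂y` in the coordinate `y = φ(x)`. -/
noncomputable def polynomialField (I : Set ℝ) (φ : ℝ → ℝ) : ℝ[X] →ₗ[ℝ] (I → ℝ) where
  toFun p x := p.eval (φ x) / deriv φ x
  map_add' p r := by ext x; simp [add_div]
  map_smul' c p := by ext x; simp [mul_div_assoc]

theorem polynomialField_apply (φ : ℝ → ℝ) (p : ℝ[X]) (x : I) :
    polynomialField I φ p x = p.eval (φ x) / deriv φ x := rfl

theorem eqOn_extendZero_polynomialField (φ : ℝ → ℝ) (p : ℝ[X]) :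
    EqOn (extendZero (polynomialField I φ p)) (fun x => p.eval (φ x) / deriv φ x) I :=
  fun _ hx => extendZero_of_mem _ hx

theorem isSmoothField_polynomialField (hI : IsOpen I) {φ : ℝ → ℝ} (hφ : ContDiffOn ℝ ∞ φ I)
    (h0 : ∀ x ∈ I, deriv φ x ≠ 0) (p : ℝ[X]) : IsSmoothField (polynomialField I φ p) := by
  have hp : ContDiff ℝ ∞ fun x => p.eval x := by simpa using p.contDiff_aeval (𝕜 := ℝ) ∞
  exact ((hp.comp_contDiffOn hφ).div (hφ.deriv_of_isOpen hI (by simp)) h0).congr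
    (eqOn_extendZero_polynomialField φ p)

/-- The bracket is coordinate-independent: the terms in `φ''` cancel. -/
theorem bracket_polynomialField (hI : IsOpen I) {φ : ℝ → ℝ} (hφ : ContDiffOn ℝ ∞ φ I)
    (h0 : ∀ x ∈ I, deriv φ x ≠ 0) (p r : ℝ[X]) :
    bracket (polynomialField I φ p) (polynomialField I φ r)
      = polynomialField I φ (p * derivative r - r * derivative p) := by
  have hd : ∀ (s : ℝ[X]) (x : I), deriv (extendZero (polynomialField I φ s)) x
      = ((derivative s).eval (φ x) * deriv φ x * deriv φ x
        - s.eval (φ x) * deriv (deriv φ) x) / deriv φ x ^ 2 := by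
    intro s x
    have h1 := ((hφ.contDiffAt (hI.mem_nhds x.2)).differentiableAt (by simp)).hasDerivAt
    have h2 := (((hφ.deriv_of_isOpen hI (m := ∞) (by simp)).contDiffAt
      (hI.mem_nhds x.2)).differentiableAt (by simp)).hasDerivAt
    have h3 := ((s.hasDerivAt (φ x)).comp (x : ℝ) h1).div h2 (h0 x x.2)
    refine (h3.congr_of_eventuallyEq ?_).deriv
    filter_upwards [hI.mem_nhds x.2] with z hz using eqOn_extendZero_polynomialField φ s hz
  ext x
  rw [bracket_apply, hd, hd]
  simp only [polynomialField_apply, eval_sub, eval_mul]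
  have := h0 x x.2
  field_simp
  ring

theorem mul_derivative_sub_mem_degreeLT {n : ℕ} {p r : ℝ[X]} (hp : p ∈ degreeLT ℝ 2)
    (hr : r ∈ degreeLT ℝ (n + 1)) : p * derivative r - r * derivative p ∈ degreeLT ℝ (n + 1) := by
  have hp1 : p.natDegree ≤ 1 :=
    natDegree_le_of_degree_le (Order.lt_succ_iff.1 (mem_degreeLT.1 hp))
  have hrn : r.natDegree ≤ n :=
    natDegree_le_of_degree_le (Order.lt_succ_iff.1 (mem_degreeLT.1 hr))
  refine Submodule.sub_mem _ ?_ ?_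
  -- For `n = 0` the truncated bound `n - 1 = 0` on the degree of the derivative would be too weak.
  · rcases Nat.eq_zero_or_pos n with rfl | hn
    · rw [eq_C_of_natDegree_le_zero hrn, derivative_C, mul_zero]
      exact Submodule.zero_mem _
    · have h1 := natDegree_derivative_le r
      have h2 := natDegree_mul_le (p := p) (q := derivative r)
      rw [mem_degreeLT]
      exact degree_le_natDegree.trans_lt (by exact_mod_cast (show _ < n + 1 by omega))
  · have h1 := natDegree_derivative_le p
    have h2 := natDegree_mul_le (p := r) (q := derivative p)
    rw [mem_degreeLT]
    exact degree_le_natDegree.trans_lt (by exact_mod_cast (show _ < n + 1 by omega))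

/-- The injective `φ` sends a neighbourhood to infinitely many roots of `p`. This serves both for
the dimensions and for faithfulness. -/
theorem eq_zero_of_eventually_polynomialField (hI : IsOpen I) {φ : ℝ → ℝ} (hinj : InjOn φ I)
    (h0 : ∀ x ∈ I, deriv φ x ≠ 0) {p : ℝ[X]} {x₀ : I}
    (h : ∀ᶠ x in 𝓝 x₀, polynomialField I φ p x = 0) : p = 0 := by
  rw [eventually_subtype_nhds hI] at h
  have hmem : {x | x ∈ I ∧ extendZero (polynomialField I φ p) x = 0} ∈ 𝓝 (x₀ : ℝ) :=
    inter_mem (hI.mem_nhds x₀.2) h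
  refine p.eq_zero_of_infinite_isRoot
    (((infinite_of_mem_nhds _ hmem).image (hinj.mono fun x hx => hx.1)).mono ?_)
  rintro _ ⟨x, ⟨hx, hx0⟩, rfl⟩
  rw [eqOn_extendZero_polynomialField φ p hx] at hx0
  exact (div_eq_zero_iff.1 hx0).resolve_right (h0 x hx)

theorem exists_isQuasiLieScheme_of_isAbel (hIo : IsOpen I) (hIn : I.Nonempty) {q : ℕ} (hq : 1 ≤ q)
    {X : ℝ → I → ℝ} (hX : IsSmoothTDepField X) {φ : OpenPartialHomeomorph ℝ ℝ} (h : φ.source = I)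
    (hφ : IsChangeOfVariables φ) (hA : IsAbel q (pushforward φ h.subset X)) :
    ∃ W V : Submodule ℝ (I → ℝ), IsQuasiLieScheme W V ∧ Module.finrank ℝ W = 2 ∧
      Module.finrank ℝ V = q + 1 ∧ (∀ x₀ : I, FaithfulAt V x₀) ∧ X ∈ quasiLieFamily V := by
  have hs : ContDiffOn ℝ ∞ φ I := h ▸ hφ.1
  have h0 : ∀ x ∈ I, deriv φ x ≠ 0 := fun x hx => hφ.deriv_ne_zero (h ▸ hx)
  have hinj : InjOn φ I := h ▸ φ.injOn
  have hL : Function.Injective (polynomialField I φ) := by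
    rw [← LinearMap.ker_eq_bot, LinearMap.ker_eq_bot']
    exact fun p hp => eq_zero_of_eventually_polynomialField hIo hinj h0
      (x₀ := ⟨_, hIn.some_mem⟩) (by simp [hp])
  have hfin : ∀ n, FiniteDimensional ℝ (degreeLT ℝ n) := fun n =>
    (degreeLTEquiv ℝ n).symm.finiteDimensional
  have hrank : ∀ n, Module.finrank ℝ ((degreeLT ℝ n).map (polynomialField I φ)) = n := fun n => by
    rw [← (Submodule.equivMapOfInjective _ hL _).finrank_eq, (degreeLTEquiv ℝ n).finrank_eq]
    simp
  refine ⟨(degreeLT ℝ 2).map (polynomialField I φ), (degreeLT ℝ (q + 1)).map (polynomialField I φ),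
    ⟨?_, inferInstance, ?_, ?_, ?_⟩, hrank 2, hrank _, ?_, hX, fun t => ?_⟩
  · rintro _ ⟨p, -, rfl⟩
    exact isSmoothField_polynomialField hIo hs h0 p
  · exact Submodule.map_mono (degreeLT_mono (by omega))
  · rintro _ ⟨p, hp, rfl⟩ _ ⟨r, hr, rfl⟩
    exact ⟨_, mul_derivative_sub_mem_degreeLT hp hr, (bracket_polynomialField hIo hs h0 p r).symm⟩
  · rintro _ ⟨p, hp, rfl⟩ _ ⟨r, hr, rfl⟩
    exact ⟨_, mul_derivative_sub_mem_degreeLT hp hr, (bracket_polynomialField hIo hs h0 p r).symm⟩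
  · rintro x₀ _ ⟨p, -, rfl⟩ hp
    rw [eq_zero_of_eventually_polynomialField hIo hinj h0 hp, map_zero]
  · obtain ⟨a, -, ha⟩ := hA
    refine ⟨∑ k : Fin (q + 1), C (a k t) * Polynomial.X ^ (k : ℕ), ?_, ?_⟩
    · refine Submodule.sum_mem _ fun k _ => mem_degreeLT.2 ((degree_C_mul_X_pow_le _ _).trans_lt ?_)
      exact_mod_cast k.2
    · ext x
      have hx : (x : ℝ) ∈ φ.source := h ▸ x.2
      have := ha t ⟨φ x, φ.map_source hx⟩
      simp only [pushforward, φ.left_inv hx] at this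
      rw [polynomialField_apply, eval_finsetSum]
      simp only [eval_mul, eval_C, eval_pow, eval_X]
      rw [← this, mul_div_cancel_left₀ _ (h0 x x.2)]

end QuasiLie

theorem mainTheorem1 (q : ℕ) (hq : 3 ≤ q) (I : Set ℝ) (hIo : IsOpen I) (hIc : IsConnected I)
    (X : ℝ → I → ℝ) (hX : QuasiLie.IsSmoothTDepField X) :
    ((∃ (φ : OpenPartialHomeomorph ℝ ℝ) (h : φ.source = I),
        QuasiLie.IsChangeOfVariables φ ∧ QuasiLie.IsAbel q (QuasiLie.pushforward φ h.subset X)) ↔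
      (∃ W V : Submodule ℝ (I → ℝ), QuasiLie.IsQuasiLieScheme W V ∧
        Module.finrank ℝ W = 2 ∧ Module.finrank ℝ V = q + 1 ∧
        (∀ x₀ : I, QuasiLie.FaithfulAt V x₀) ∧ X ∈ QuasiLie.quasiLieFamily V)) ∧
    (∀ W V : Submodule ℝ (I → ℝ), QuasiLie.IsQuasiLieScheme W V →
      Module.finrank ℝ W = 2 → Module.finrank ℝ V = q + 1 → X ∈ QuasiLie.quasiLieFamily V →
      ∀ x₀ : I, QuasiLie.FaithfulAt W x₀ → (∃ w ∈ W, w x₀ ≠ 0) →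
        ∃ (φ : OpenPartialHomeomorph ℝ ℝ) (h : φ.source ⊆ I), (x₀ : ℝ) ∈ φ.source ∧
          QuasiLie.IsChangeOfVariables φ ∧ QuasiLie.IsAbel q (QuasiLie.pushforward φ h X)) := by
  refine ⟨⟨?_, ?_⟩, ?_⟩
  · rintro ⟨φ, h, hφ, hA⟩
    exact QuasiLie.exists_isQuasiLieScheme_of_isAbel hIo hIc.nonempty (by omega) hX h hφ hA
  · rintro ⟨W, V, S, hW, hV, hfaith, hXV⟩
    have hne : W ≠ ⊥ := by
      rintro rfl
      simp at hW
    obtain ⟨w, hw, hw0⟩ := W.exists_mem_ne_zero_of_ne_bot hne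
    obtain ⟨x₁, hx₁⟩ := Function.ne_iff.1 hw0
    obtain ⟨f, hf, g, hg, hfg, hg1⟩ := QuasiLie.exists_affine_pair hIo
      (fun f hf => S.smooth f (S.le hf)) S.bracket_mem hW ((hfaith x₁).mono S.le) hw hx₁
    -- Since `g` has no zero, `U = I` is allowed and the chart is global.
    obtain ⟨φ, h, hφI, hφ, hA⟩ := S.exists_isAbel hIo hf hg hfg hV hXV hIo hIc subset_rfl
      (S.extendZero_ne_zero hIo hIc.isPreconnected hf hg hfg hq hV hfaith x₁.2
        (by rwa [QuasiLie.extendZero_apply]))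
    exact ⟨φ, hφI, hφ, hA⟩
  · rintro W V S hW hV hXV x₀ hfaith ⟨w, hw, hw0⟩
    obtain ⟨f, hf, g, hg, hfg, hg0⟩ := QuasiLie.exists_affine_pair hIo
      (fun f hf => S.smooth f (S.le hf)) S.bracket_mem hW hfaith hw hw0
    obtain ⟨a, b, hx₀, hab⟩ := mem_nhds_iff_exists_Ioo_subset.1
      ((S.smooth g (S.le hg)).eventually_ne hIo x₀.2 (by rwa [QuasiLie.extendZero_apply]))
    obtain ⟨φ, h, hφU, hφ, hA⟩ := S.exists_isAbel hIo hf hg hfg hV hXV isOpen_Ioo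
      (isConnected_Ioo (hx₀.1.trans hx₀.2)) (fun x hx => (hab hx).1) (fun x hx => (hab hx).2)
    exact ⟨φ, h, hφU ▸ hx₀, hφ, hA⟩
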